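/- For a function $u:\mathbb{R}\to\mathbb{R}$ with $u\in L^4(\mathbb{R})$, $u\not\equiv 0$ (that is, $u$ is not almost everywhere $0$), and whose second derivative $u''$ in the sense of distributions belongs to $L^2(\mathbb{R})$, set $$Q_{\mathbb{R}}(u):=\frac{\int_{\mathbb{R}} (u'')^2\,dx-\int_{\mathbb{R}} u''\,u^2\,dx}{\int_{\mathbb{R}} u^4\,dx},$$ and let $$I:=\inf\Big\{Q_{\mathbb{R}}(u)\;:\; u\not\equiv 0,\ u\in L^4(\mathbb{R}),\ u''\in L^2(\mathbb{R})\Big\}.$$ Then $I$ is a (finite) real number, and the infimum is not achieved: there is no $u\in L^4(\mathbb{R})$ with $u\not\equiv 0$ and $u''\in L^2(\mathbb{R})$ such that $Q_{\mathbb{R}}(u)=I$. -/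

import Mathlib

open MeasureTheory
open scoped ContDiff

/-- `g` is the second derivative of `u` on `ℝ` in the sense of distributions: both functions are
locally integrable and `∫ u φ'' = ∫ g φ` for every test function `φ ∈ C_c^∞(ℝ)`. -/
structure IsWeakSecondDeriv (u g : ℝ → ℝ) : Prop where
  locallyIntegrable : LocallyIntegrable u volume
  locallyIntegrable_deriv : LocallyIntegrable g volume
  integral_eq : ∀ φ : ℝ → ℝ, ContDiff ℝ ∞ φ → HasCompactSupport φ →
    ∫ x, u x * deriv (deriv φ) x = ∫ x, g x * φ x

/-- `u` is a competitor with distributional second derivative `u2` (unique up to null sets):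
`u ∈ L⁴(ℝ)`, `u'' = u2 ∈ L²(ℝ)`, and `u` is not (almost everywhere) zero. -/
structure IsCompetitor (u u2 : ℝ → ℝ) : Prop where
  memLp_four : MemLp u 4 volume
  isWeakSecondDeriv : IsWeakSecondDeriv u u2
  memLp_two : MemLp u2 2 volume
  not_ae_zero : ¬ (∀ᵐ x, u x = 0)

/-- The quotient `Q_ℝ(u) = (∫ (u'')² - ∫ u'' u²) / ∫ u⁴`, where `u2` stands for `u''`. -/
noncomputable def quotientQ (u u2 : ℝ → ℝ) : ℝ :=
  ((∫ x, u2 x ^ 2) - ∫ x, u2 x * u x ^ 2) / ∫ x, u x ^ 4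

/-- The set of all values of `Q_ℝ` on competitors. -/
def quotientValues : Set ℝ :=
  {q | ∃ u u2 : ℝ → ℝ, IsCompetitor u u2 ∧ quotientQ u u2 = q}

/-- The constant `I`, the infimum of `Q_ℝ` over all competitors. -/
noncomputable def infimumI : ℝ := sInf quotientValues

/-! Put J = -I. By definition of I the functional E(u) = ∫ (u'')² - u'' u² + J u⁴ is nonnegative on
all admissible functions, and a competitor attains I exactly when E(u) = 0. Completing the square
gives I ≥ -1/4, and scaling u to λu with λ → ∞ sends Q to 0, so J ≥ 0.

Suppose E(u) = 0 with u nonzero. Then u minimizes E, hence solves the fourth-order Euler-Lagrange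
equation classically (`EnergyNonneg.exists_isSolution`). Finite energy makes u and u' tend to 0 at
infinity and makes the conserved Hamiltonian vanish (`IsSolution.hamiltonian_eq_zero`).

The key step is reflection. At a critical point c, the even reflections of the two halves of u are
admissible and their energies add up to 2 E(u) = 0, so both are minimizers. The reflected right half
solves the same equation and has the Cauchy data of u at c, so u is even about c
(`IsSolution.symmetric`). Two critical points would make u periodic, against decay; since u² has a
positive maximum, there is exactly one, and u is strictly monotone to its right.

If u increases there, it is negative, and the signs of u'', u''' and u'''' are incompatible with u <
0 < u' (`IsSolution.not_deriv_pos`). If it decreases, then u ≥ 0 everywhere, so ∫ u'' u² = -2 ∫ u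
(u')² ≤ 0; every term of E(u) = 0 is then nonnegative, which forces u'' = 0 and contradicts u' < 0
to the right of c. -/

open Set Filter Topology

/-! ### Distributional second derivatives and regular representatives. -/

/-- A test function with zero integral is the derivative of a test function. -/
theorem exists_deriv_eq_of_integral_eq_zero {ψ : ℝ → ℝ} (hψ : ContDiff ℝ ∞ ψ)
    (hc : HasCompactSupport ψ) (h0 : ∫ x, ψ x = 0) :
    ∃ Ψ : ℝ → ℝ, ContDiff ℝ ∞ Ψ ∧ HasCompactSupport Ψ ∧ deriv Ψ = ψ := by
  obtain ⟨R, hR⟩ := hc.isCompact.isBounded.subset_closedBall 0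
  have hz : ∀ x, x ∉ Icc (-R) R → ψ x = 0 := fun x hx => by
    by_contra h
    have := hR (subset_tsupport ψ h)
    rw [Real.closedBall_eq_Icc] at this
    exact hx (by simpa using this)
  have hi : Integrable ψ := hψ.continuous.integrable_of_hasCompactSupport hc
  have hd : ∀ x, HasDerivAt (fun x => ∫ t in Iic x, ψ t) (ψ x) x := fun x => by
    have h1 : (fun x => ∫ t in Iic x, ψ t)
        = fun x => (∫ t in Iic (0 : ℝ), ψ t) + ∫ t in (0 : ℝ)..x, ψ t := by
      ext y
      rw [← intervalIntegral.integral_Iic_sub_Iic hi.integrableOn hi.integrableOn]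
      ring
    rw [h1]
    exact (hψ.continuous.integral_hasStrictDerivAt 0 x).hasDerivAt.const_add _
  have hde : deriv (fun x => ∫ t in Iic x, ψ t) = ψ := funext fun x => (hd x).deriv
  refine ⟨fun x => ∫ t in Iic x, ψ t, ?_, ?_, hde⟩
  · rw [contDiff_infty_iff_deriv, hde]
    exact ⟨fun x => (hd x).differentiableAt, hψ⟩
  · refine HasCompactSupport.intro (isCompact_Icc (a := -R) (b := R)) fun x hx => ?_
    by_cases hx' : x < -R
    · exact setIntegral_eq_zero_of_forall_eq_zero fun t ht => hz t fun h =>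
        absurd (h.1.trans ht) (not_le.2 hx')
    · have hxR : R < x := by
        by_contra h
        exact hx ⟨not_lt.1 hx', not_lt.1 h⟩
      have h2 := intervalIntegral.integral_Iic_add_Ioi (b := x) hi.integrableOn hi.integrableOn
      have h3 : ∫ t in Ioi x, ψ t = 0 := setIntegral_eq_zero_of_forall_eq_zero fun t ht =>
        hz t fun h => absurd (h.2.trans_lt hxR) (not_lt.2 (le_of_lt ht))
      rw [h0, h3, add_zero] at h2
      exact h2

theorem exists_test_integral_eq_one :
    ∃ ρ : ℝ → ℝ, ContDiff ℝ ∞ ρ ∧ HasCompactSupport ρ ∧ ∫ x, ρ x = 1 := by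
  let b : ContDiffBump (0 : ℝ) := ⟨1, 2, one_pos, one_lt_two⟩
  exact ⟨b.normed volume, b.contDiff_normed, b.hasCompactSupport_normed, b.integral_normed⟩

/-- A linear functional on test functions that kills derivatives is a multiple of the integral. -/
theorem exists_eq_mul_integral_of_deriv {T : (ℝ → ℝ) → ℝ}
    (hlin : ∀ φ ψ : ℝ → ℝ, ContDiff ℝ ∞ φ → HasCompactSupport φ → ContDiff ℝ ∞ ψ →
      HasCompactSupport ψ → ∀ c : ℝ, T (fun x => φ x - c * ψ x) = T φ - c * T ψ)
    (hT : ∀ φ : ℝ → ℝ, ContDiff ℝ ∞ φ → HasCompactSupport φ → T (deriv φ) = 0) :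
    ∃ β : ℝ, ∀ ψ : ℝ → ℝ, ContDiff ℝ ∞ ψ → HasCompactSupport ψ → T ψ = β * ∫ x, ψ x := by
  obtain ⟨ρ, hρ, hρc, hρ1⟩ := exists_test_integral_eq_one
  refine ⟨T ρ, fun ψ hψ hψc => ?_⟩
  have hi : Integrable ψ := hψ.continuous.integrable_of_hasCompactSupport hψc
  have hiρ : Integrable ρ := hρ.continuous.integrable_of_hasCompactSupport hρc
  -- Removing the mean of `ψ` with `ρ` leaves a zero-integral test function, hence a derivative,
  -- which `T` kills.
  have hcs : HasCompactSupport fun x => ψ x - (∫ x, ψ x) * ρ x := hψc.sub hρc.mul_left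
  obtain ⟨Ψ, h1, h2, h3⟩ := exists_deriv_eq_of_integral_eq_zero
    (ψ := fun x => ψ x - (∫ x, ψ x) * ρ x) (hψ.sub (contDiff_const.mul hρ)) hcs (by
      rw [integral_sub hi (hiρ.const_mul _), integral_const_mul, hρ1]; ring)
  have h4 := hT Ψ h1 h2
  rw [h3, hlin ψ ρ hψ hψc hρ hρc] at h4
  linarith

theorem MeasureTheory.LocallyIntegrable.integrable_mul_of_hasCompactSupport {f φ : ℝ → ℝ}
    (hf : LocallyIntegrable f volume) (hφ : Continuous φ) (hc : HasCompactSupport φ) :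
    Integrable fun x => f x * φ x :=
  hf.integrable_smul_right_of_hasCompactSupport hφ hc

theorem integral_mul_deriv_test {f f' φ : ℝ → ℝ} (hf : ∀ x, HasDerivAt f (f' x) x)
    (hf' : LocallyIntegrable f' volume) (hφ : ContDiff ℝ ∞ φ) (hc : HasCompactSupport φ) :
    ∫ x, f x * deriv φ x = -∫ x, f' x * φ x := by
  have hfc : Continuous f := continuous_iff_continuousAt.2 fun x => (hf x).continuousAt
  refine integral_mul_deriv_eq_deriv_mul_of_integrable (fun x _ => hf x)
    (fun x _ => (hφ.differentiable (by simp) x).hasDerivAt) ?_ ?_ ?_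
  · exact hfc.locallyIntegrable.integrable_mul_of_hasCompactSupport
      (hφ.continuous_deriv (by simp)) hc.deriv
  · exact hf'.integrable_mul_of_hasCompactSupport hφ.continuous hc
  · exact hfc.locallyIntegrable.integrable_mul_of_hasCompactSupport hφ.continuous hc

theorem contDiff_deriv_test {φ : ℝ → ℝ} (hφ : ContDiff ℝ ∞ φ) : ContDiff ℝ ∞ (deriv φ) :=
  (contDiff_infty_iff_deriv.1 hφ).2

/-- A locally integrable function with vanishing second distributional derivative is affine. -/
theorem ae_eq_affine_of_integral_deriv_deriv_eq_zero {d : ℝ → ℝ}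
    (hd : LocallyIntegrable d volume)
    (h : ∀ φ : ℝ → ℝ, ContDiff ℝ ∞ φ → HasCompactSupport φ → ∫ x, d x * deriv (deriv φ) x = 0) :
    ∃ α β : ℝ, ∀ᵐ x, d x = α + β * x := by
  -- The functional gives `∫ d ψ' = β ∫ ψ`, that is, `d' = -β` in the sense of distributions.
  obtain ⟨β, hβ⟩ := exists_eq_mul_integral_of_deriv (T := fun ψ => ∫ x, d x * deriv ψ x)
    (fun φ ψ hφ hφc hψ hψc c => by
      have e : (fun x => d x * deriv (fun x => φ x - c * ψ x) x)
          = fun x => d x * deriv φ x - c * (d x * deriv ψ x) := by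
        ext x
        rw [(((hφ.differentiable (by simp) x).hasDerivAt).fun_sub
          ((hψ.differentiable (by simp) x).hasDerivAt.const_mul c)).deriv]
        ring
      simp only [e]
      rw [integral_sub, integral_const_mul]
      · exact hd.integrable_mul_of_hasCompactSupport (hφ.continuous_deriv (by simp)) hφc.deriv
      · exact (hd.integrable_mul_of_hasCompactSupport (hψ.continuous_deriv (by simp))
          hψc.deriv).const_mul c) h
  have hl : LocallyIntegrable (fun x => d x + β * x) volume :=
    hd.add (by fun_prop : Continuous fun x : ℝ => β * x).locallyIntegrable
  -- Once the slope is removed, `d + β x` has zero derivative and is the constant `α`.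
  obtain ⟨α, hα⟩ := exists_eq_mul_integral_of_deriv (T := fun ψ => ∫ x, (d x + β * x) * ψ x)
    (fun φ ψ hφ hφc hψ hψc c => by
      have e : (fun x => (d x + β * x) * (φ x - c * ψ x))
          = fun x => (d x + β * x) * φ x - c * ((d x + β * x) * ψ x) := by
        ext x; ring
      simp only [e]
      rw [integral_sub, integral_const_mul]
      · exact hl.integrable_mul_of_hasCompactSupport hφ.continuous hφc
      · exact (hl.integrable_mul_of_hasCompactSupport hψ.continuous hψc).const_mul c)
    (fun φ hφ hφc => by
      have h1 : ∫ x, (β * x) * deriv φ x = -∫ x, β * φ x :=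
        integral_mul_deriv_test (f' := fun _ => β)
          (fun x => by simpa using (hasDerivAt_id x).const_mul β)
          continuous_const.locallyIntegrable hφ hφc
      have e : (fun x => (d x + β * x) * deriv φ x)
          = fun x => d x * deriv φ x + (β * x) * deriv φ x := by
        ext x; ring
      simp only [e]
      rw [integral_add, h1, hβ φ hφ hφc, integral_const_mul]
      · ring
      · exact hd.integrable_mul_of_hasCompactSupport (hφ.continuous_deriv (by simp)) hφc.deriv
      · exact (by fun_prop : Continuous fun x : ℝ => β * x).locallyIntegrable
          |>.integrable_mul_of_hasCompactSupport (hφ.continuous_deriv (by simp)) hφc.deriv)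
  refine ⟨α, -β, ?_⟩
  have := ae_eq_of_integral_contDiff_smul_eq (f' := fun _ => α) hl
    continuous_const.locallyIntegrable fun g hg hgc => by
      simp only [smul_eq_mul, mul_comm (g _)]
      rw [hα g hg hgc, integral_const_mul]
  filter_upwards [this] with x hx
  linarith

/-- Integration by parts of a test function against a primitive of a locally integrable
function. -/
theorem integral_primitive_mul_deriv_test {h φ : ℝ → ℝ} (hh : LocallyIntegrable h volume)
    (hφ : ContDiff ℝ ∞ φ) (hc : HasCompactSupport φ) :
    ∫ x, (∫ t in (0 : ℝ)..x, h t) * deriv φ x = -∫ x, h x * φ x := by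
  obtain ⟨R, hR⟩ := hc.isCompact.isBounded.subset_closedBall 0
  rw [Real.closedBall_eq_Icc, zero_sub, zero_add] at hR
  -- The margin 1 keeps the support off both endpoints, so boundary terms vanish; `|R|` covers
  -- negative `R`.
  have hR' : tsupport φ ⊆ Ioc (-(|R| + 1)) (|R| + 1) := fun x hx =>
    ⟨by linarith [(hR hx).1, le_abs_self R], by linarith [(hR hx).2, le_abs_self R]⟩
  have hle : -(|R| + 1) ≤ |R| + 1 := by linarith [abs_nonneg R]
  have hii : ∀ a b, IntervalIntegrable h volume a b := fun a b =>
    (hh.integrableOn_isCompact isCompact_uIcc).intervalIntegrable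
  have ac1 := (hii (-(|R| + 1)) (|R| + 1)).absolutelyContinuousOnInterval_intervalIntegral
    (c := 0) (by rw [uIcc_of_le hle]; constructor <;> linarith [abs_nonneg R])
  have ac2 : AbsolutelyContinuousOnInterval φ (-(|R| + 1)) (|R| + 1) :=
    (hφ.of_le (by simp)).contDiffOn.absolutelyContinuousOnInterval
  have key := ac1.integral_mul_deriv_eq_deriv_mul ac2
  have z1 : φ (|R| + 1) = 0 := image_eq_zero_of_notMem_tsupport fun hx => by
    linarith [(hR hx).2, le_abs_self R]
  have z2 : φ (-(|R| + 1)) = 0 := image_eq_zero_of_notMem_tsupport fun hx => by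
    linarith [(hR hx).1, le_abs_self R]
  rw [z1, z2, mul_zero, mul_zero, sub_zero, zero_sub] at key
  have e1 : ∫ x in (-(|R| + 1))..(|R| + 1), (∫ t in (0 : ℝ)..x, h t) * deriv φ x
      = ∫ x, (∫ t in (0 : ℝ)..x, h t) * deriv φ x := by
    refine intervalIntegral.integral_eq_integral_of_support_subset fun x hx => hR' ?_
    exact tsupport_deriv_subset (subset_tsupport (deriv φ) (right_ne_zero_of_mul hx))
  have e2 : ∫ x in (-(|R| + 1))..(|R| + 1), deriv (fun x => ∫ t in (0 : ℝ)..x, h t) x * φ x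
      = ∫ x, h x * φ x := by
    rw [← intervalIntegral.integral_eq_integral_of_support_subset (a := -(|R| + 1))
      (b := |R| + 1) (f := fun x => h x * φ x)
      fun x hx => hR' (subset_tsupport _ fun h0 => hx (by simp [h0]))]
    refine intervalIntegral.integral_congr_ae ?_
    filter_upwards [LocallyIntegrable.ae_hasDerivAt_integral hh] with x hx _
    rw [(hx 0).deriv]
  rw [← e1, key, e2]

/-- A function with a locally integrable distributional second derivative has a `C¹`
representative whose derivative is a primitive of it. -/
theorem IsWeakSecondDeriv.exists_C1 {f h : ℝ → ℝ} (hf : IsWeakSecondDeriv f h) :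
    ∃ U P : ℝ → ℝ, (∀ x, HasDerivAt U (P x) x) ∧ Continuous P ∧
      (∀ x y, P y - P x = ∫ t in x..y, h t) ∧ f =ᵐ[volume] U := by
  have hh := hf.locallyIntegrable_deriv
  have hii : ∀ a b, IntervalIntegrable h volume a b := fun a b =>
    (hh.integrableOn_isCompact isCompact_uIcc).intervalIntegrable
  set P : ℝ → ℝ := fun x => ∫ t in (0 : ℝ)..x, h t with hP
  have hPc : Continuous P := intervalIntegral.continuous_primitive hii 0
  set U : ℝ → ℝ := fun x => ∫ t in (0 : ℝ)..x, P t with hU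
  have hUd : ∀ x, HasDerivAt U (P x) x := fun x =>
    (hPc.integral_hasStrictDerivAt 0 x).hasDerivAt
  have hUc : Continuous U := continuous_iff_continuousAt.2 fun x => (hUd x).continuousAt
  obtain ⟨α, β, hαβ⟩ := ae_eq_affine_of_integral_deriv_deriv_eq_zero
    (d := fun x => f x - U x) (hf.locallyIntegrable.sub hUc.locallyIntegrable) (fun φ hφ hc => by
      have hφ' := contDiff_deriv_test hφ
      have c2 := hφ'.continuous_deriv (by simp)
      simp only [sub_mul]
      rw [integral_sub (hf.locallyIntegrable.integrable_mul_of_hasCompactSupport c2 hc.deriv.deriv)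
        (hUc.locallyIntegrable.integrable_mul_of_hasCompactSupport c2 hc.deriv.deriv),
        hf.integral_eq φ hφ hc, integral_mul_deriv_test hUd hPc.locallyIntegrable hφ' hc.deriv,
        integral_primitive_mul_deriv_test hh hφ hc]
      ring)
  refine ⟨fun x => U x + (α + β * x), fun x => P x + β, fun x => ?_, hPc.add continuous_const,
    fun x y => ?_, ?_⟩
  · have := (hUd x).fun_add (((hasDerivAt_id x).const_mul β).const_add α)
    simpa using this
  · simp only [hP, add_sub_add_right_eq_sub]
    exact intervalIntegral.integral_interval_sub_left (hii _ _) (hii _ _)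
  · filter_upwards [hαβ] with x hx
    linarith

theorem hasDerivAt_of_integral_eq_sub {h P : ℝ → ℝ} (hh : Continuous h)
    (hP : ∀ x y, P y - P x = ∫ t in x..y, h t) (x : ℝ) : HasDerivAt P (h x) x := by
  have e : P = fun y => P 0 + ∫ t in (0 : ℝ)..y, h t := by
    ext y
    rw [← hP 0 y]; ring
  rw [e]
  exact (hh.integral_hasStrictDerivAt 0 x).hasDerivAt.const_add _

/-! ### The energy and its Euler-Lagrange equation. -/

/-- The functional `∫ (u'')² - u'' u² + J u⁴`, where `g` stands for `u''`. -/
noncomputable def energy (J : ℝ) (u g : ℝ → ℝ) : ℝ :=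
  ∫ x, (g x ^ 2 - g x * u x ^ 2 + J * u x ^ 4)

/-- The functional `energy J` is nonnegative on all admissible functions. -/
def EnergyNonneg (J : ℝ) : Prop :=
  ∀ u g : ℝ → ℝ, MemLp u 4 volume → MemLp g 2 volume → IsWeakSecondDeriv u g → 0 ≤ energy J u g

/-- `u` solves the Euler-Lagrange equation `u'''' = (u')² + 2 u u'' - 2 J u³`; the functions
`u1`, `u2`, `u3` are its first three derivatives. -/
structure IsSolution (J : ℝ) (u u1 u2 u3 : ℝ → ℝ) : Prop where
  deriv0 : ∀ x, HasDerivAt u (u1 x) x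
  deriv1 : ∀ x, HasDerivAt u1 (u2 x) x
  deriv2 : ∀ x, HasDerivAt u2 (u3 x) x
  deriv3 : ∀ x, HasDerivAt u3 (u1 x ^ 2 + 2 * u x * u2 x - 2 * J * u x ^ 3) x

theorem MeasureTheory.MemLp.integrable_pow_four {u : ℝ → ℝ} (hu : MemLp u 4 volume) :
    Integrable fun x => u x ^ 4 := by
  have := hu.integrable_norm_pow (p := 4) (by norm_num)
  refine this.congr (ae_of_all _ fun x => ?_)
  simp [Real.norm_eq_abs, (show Even 4 by decide).pow_abs]

theorem MeasureTheory.MemLp.sq_memLp_two {u : ℝ → ℝ} (hu : MemLp u 4 volume) :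
    MemLp (fun x => u x ^ 2) 2 volume := by
  refine (memLp_two_iff_integrable_sq (hu.1.pow 2)).2 ?_
  refine hu.integrable_pow_four.congr (ae_of_all _ fun x => ?_)
  simp only [Pi.pow_apply]
  ring

theorem integrable_mul_sq {u g : ℝ → ℝ} (hu : MemLp u 4 volume) (hg : MemLp g 2 volume) :
    Integrable fun x => g x * u x ^ 2 :=
  hg.integrable_mul hu.sq_memLp_two

theorem integrable_energy_density (J : ℝ) {u g : ℝ → ℝ} (hu : MemLp u 4 volume)
    (hg : MemLp g 2 volume) :
    Integrable fun x => g x ^ 2 - g x * u x ^ 2 + J * u x ^ 4 :=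
  (hg.integrable_sq.sub (integrable_mul_sq hu hg)).add (hu.integrable_pow_four.const_mul J)

theorem energy_eq (J : ℝ) {u g : ℝ → ℝ} (hu : MemLp u 4 volume) (hg : MemLp g 2 volume) :
    energy J u g = (∫ x, g x ^ 2) - (∫ x, g x * u x ^ 2) + J * ∫ x, u x ^ 4 := by
  rw [← integral_sub hg.integrable_sq (integrable_mul_sq hu hg), ← integral_const_mul]
  exact integral_add (hg.integrable_sq.sub (integrable_mul_sq hu hg))
    (hu.integrable_pow_four.const_mul J)

theorem energy_congr (J : ℝ) {u u' g g' : ℝ → ℝ} (hu : u =ᵐ[volume] u') (hg : g =ᵐ[volume] g') :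
    energy J u g = energy J u' g' := by
  refine integral_congr_ae ?_
  filter_upwards [hu, hg] with x h1 h2
  rw [h1, h2]

theorem IsWeakSecondDeriv.congr {u u' g g' : ℝ → ℝ} (h : IsWeakSecondDeriv u g)
    (hu : u =ᵐ[volume] u') (hg : g =ᵐ[volume] g') : IsWeakSecondDeriv u' g' where
  locallyIntegrable := h.locallyIntegrable.congr hu
  locallyIntegrable_deriv := h.locallyIntegrable_deriv.congr hg
  integral_eq φ hφ hc := by
    exact (integral_congr_ae (hu.mul (ae_eq_refl (deriv (deriv φ))))).symm.trans
      ((h.integral_eq φ hφ hc).trans (integral_congr_ae (hg.mul (ae_eq_refl φ))))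

theorem isWeakSecondDeriv_of_hasDerivAt {u u1 u2 : ℝ → ℝ} (h0 : ∀ x, HasDerivAt u (u1 x) x)
    (h1 : ∀ x, HasDerivAt u1 (u2 x) x) (h2 : Continuous u2) : IsWeakSecondDeriv u u2 where
  locallyIntegrable :=
    (continuous_iff_continuousAt.2 fun x => (h0 x).continuousAt).locallyIntegrable
  locallyIntegrable_deriv := h2.locallyIntegrable
  integral_eq φ hφ hc := by
    have c1 : Continuous u1 := continuous_iff_continuousAt.2 fun x => (h1 x).continuousAt
    rw [integral_mul_deriv_test h0 c1.locallyIntegrable (contDiff_deriv_test hφ) hc.deriv,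
      integral_mul_deriv_test h1 h2.locallyIntegrable hφ hc, neg_neg]

theorem isWeakSecondDeriv_test {φ : ℝ → ℝ} (hφ : ContDiff ℝ ∞ φ) :
    IsWeakSecondDeriv φ (deriv (deriv φ)) :=
  isWeakSecondDeriv_of_hasDerivAt (fun x => (hφ.differentiable (by simp) x).hasDerivAt)
    (fun x => ((contDiff_deriv_test hφ).differentiable (by simp) x).hasDerivAt)
    ((contDiff_deriv_test hφ).continuous_deriv (by simp))

theorem IsWeakSecondDeriv.add {u g v h : ℝ → ℝ} (hu : IsWeakSecondDeriv u g)
    (hv : IsWeakSecondDeriv v h) :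
    IsWeakSecondDeriv (fun x => u x + v x) (fun x => g x + h x) where
  locallyIntegrable := hu.locallyIntegrable.add hv.locallyIntegrable
  locallyIntegrable_deriv := hu.locallyIntegrable_deriv.add hv.locallyIntegrable_deriv
  integral_eq φ hφ hc := by
    have c2 := (contDiff_deriv_test hφ).continuous_deriv (by simp)
    simp only [add_mul]
    rw [integral_add (hu.locallyIntegrable.integrable_mul_of_hasCompactSupport c2 hc.deriv.deriv)
      (hv.locallyIntegrable.integrable_mul_of_hasCompactSupport c2 hc.deriv.deriv),
      integral_add
        (hu.locallyIntegrable_deriv.integrable_mul_of_hasCompactSupport hφ.continuous hc)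
        (hv.locallyIntegrable_deriv.integrable_mul_of_hasCompactSupport hφ.continuous hc),
      hu.integral_eq φ hφ hc, hv.integral_eq φ hφ hc]

theorem IsWeakSecondDeriv.const_mul {u g : ℝ → ℝ} (hu : IsWeakSecondDeriv u g) (c : ℝ) :
    IsWeakSecondDeriv (fun x => c * u x) (fun x => c * g x) where
  locallyIntegrable := hu.locallyIntegrable.smul c
  locallyIntegrable_deriv := hu.locallyIntegrable_deriv.smul c
  integral_eq φ hφ hc := by
    simp only [mul_assoc, integral_const_mul, hu.integral_eq φ hφ hc]

theorem integral_add_four {a b c d e : ℝ → ℝ} (ha : Integrable a) (hb : Integrable b)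
    (hc : Integrable c) (hd : Integrable d) (he : Integrable e) :
    ∫ x, (a x + b x + c x + d x + e x)
      = (∫ x, a x) + (∫ x, b x) + (∫ x, c x) + (∫ x, d x) + ∫ x, e x := by
  have h1 : Integrable fun x => a x + b x := ha.add hb
  have h2 : Integrable fun x => a x + b x + c x := h1.add hc
  have h3 : Integrable fun x => a x + b x + c x + d x := h2.add hd
  rw [← integral_add ha hb, ← integral_add h1 hc, ← integral_add h2 hd, ← integral_add h3 he]

theorem linear_coeff_eq_zero {a b c d : ℝ}
    (h : ∀ t : ℝ, 0 ≤ t * a + t ^ 2 * b + t ^ 3 * c + t ^ 4 * d) : a = 0 := by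
  have hm : IsLocalMin (fun t : ℝ => t * a + t ^ 2 * b + t ^ 3 * c + t ^ 4 * d) 0 :=
    Eventually.of_forall fun t => by simpa using h t
  refine hm.hasDerivAt_eq_zero ?_
  have := ((((hasDerivAt_id (0 : ℝ)).mul_const a).fun_add
    ((hasDerivAt_pow 2 (0 : ℝ)).mul_const b)).fun_add
    ((hasDerivAt_pow 3 (0 : ℝ)).mul_const c)).fun_add ((hasDerivAt_pow 4 (0 : ℝ)).mul_const d)
  simpa using this

/-- First variation: the Euler-Lagrange equation in the sense of distributions. -/
theorem EnergyNonneg.isWeakSecondDeriv {J : ℝ} (hJ : EnergyNonneg J) {u g : ℝ → ℝ}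
    (hu : MemLp u 4 volume) (hg : MemLp g 2 volume) (hw : IsWeakSecondDeriv u g)
    (hE : energy J u g = 0) (huc : Continuous u) :
    IsWeakSecondDeriv (fun x => 2 * g x - u x ^ 2)
      (fun x => 2 * (g x * u x) - 4 * J * u x ^ 3) := by
  have lg := hw.locallyIntegrable_deriv
  have l1 : LocallyIntegrable (fun x => 2 * g x - u x ^ 2) volume :=
    (lg.smul (2 : ℝ)).sub (huc.fun_pow 2).locallyIntegrable
  have l2 : LocallyIntegrable (fun x => 2 * (g x * u x) - 4 * J * u x ^ 3) volume :=
    ((lg.mul_continuous huc).smul (2 : ℝ)).sub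
      (by fun_prop : Continuous fun x => 4 * J * u x ^ 3).locallyIntegrable
  refine ⟨l1, l2, fun φ hφ hc => ?_⟩
  have cφ := hφ.continuous
  have c2 := (contDiff_deriv_test hφ).continuous_deriv (by simp)
  set ψ := deriv (deriv φ) with hψ
  have hψc : HasCompactSupport ψ := hc.deriv.deriv
  have i1 := l1.integrable_mul_of_hasCompactSupport c2 hψc
  have i2 := l2.integrable_mul_of_hasCompactSupport cφ hc
  have i3 : Integrable fun x => ψ x ^ 2 - 2 * u x * φ x * ψ x - g x * (φ x * φ x)
      + 6 * J * u x ^ 2 * φ x ^ 2 := by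
    refine Integrable.add (Integrable.sub ?_
      (lg.integrable_mul_of_hasCompactSupport (cφ.mul cφ) hc.mul_left)) ?_
    · refine Continuous.integrable_of_hasCompactSupport (by fun_prop) ?_
      refine hψc.mono fun x hx => ?_
      contrapose! hx
      simp [Function.notMem_support.1 hx]
    · refine Continuous.integrable_of_hasCompactSupport (by fun_prop) ?_
      refine hc.mono fun x hx => ?_
      contrapose! hx
      simp [Function.notMem_support.1 hx]
  have i4 : Integrable fun x => -(ψ x * φ x ^ 2) + 4 * J * u x * φ x ^ 3 := by
    refine Continuous.integrable_of_hasCompactSupport (by fun_prop) ?_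
    refine hc.mono fun x hx => ?_
    contrapose! hx
    simp [Function.notMem_support.1 hx]
  have i5 : Integrable fun x => J * φ x ^ 4 := by
    refine Continuous.integrable_of_hasCompactSupport (by fun_prop) ?_
    refine hc.mono fun x hx => ?_
    contrapose! hx
    simp [Function.notMem_support.1 hx]
  have i0 := integrable_energy_density J hu hg
  -- Along `u + t φ` the energy is exactly a quartic in `t` without constant term; it is
  -- nonnegative, so its linear coefficient, the weak equation tested on `φ`, vanishes.
  have key : ∀ t : ℝ, energy J (fun x => u x + t * φ x) (fun x => g x + t * ψ x)
      = t * ((∫ x, (2 * g x - u x ^ 2) * ψ x) - ∫ x, (2 * (g x * u x) - 4 * J * u x ^ 3) * φ x)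
        + t ^ 2 * (∫ x, (ψ x ^ 2 - 2 * u x * φ x * ψ x - g x * (φ x * φ x)
          + 6 * J * u x ^ 2 * φ x ^ 2))
        + t ^ 3 * (∫ x, (-(ψ x * φ x ^ 2) + 4 * J * u x * φ x ^ 3))
        + t ^ 4 * ∫ x, J * φ x ^ 4 := fun t => by
    have j1 : Integrable fun x => t * ((2 * g x - u x ^ 2) * ψ x
        - (2 * (g x * u x) - 4 * J * u x ^ 3) * φ x) := (i1.sub i2).const_mul t
    rw [← zero_add (t * _), ← hE, ← integral_sub i1 i2, ← integral_const_mul,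
      ← integral_const_mul, ← integral_const_mul, ← integral_const_mul, energy, energy,
      ← integral_add_four i0 j1 (i3.const_mul _) (i4.const_mul _)
        (i5.const_mul _)]
    refine integral_congr_ae (ae_of_all _ fun x => ?_)
    ring
  have := linear_coeff_eq_zero fun t => (key t) ▸ hJ _ _
    (hu.add ((cφ.memLp_of_hasCompactSupport hc).const_mul t))
    (hg.add ((c2.memLp_of_hasCompactSupport hψc).const_mul t))
    (hw.add ((isWeakSecondDeriv_test hφ).const_mul t))
  linarith

/-- Zeros of a nonnegative `energy J` are classical solutions of the Euler-Lagrange equation. -/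
theorem EnergyNonneg.exists_isSolution {J : ℝ} (hJ : EnergyNonneg J) {u g : ℝ → ℝ}
    (hu : MemLp u 4 volume) (hg : MemLp g 2 volume) (hw : IsWeakSecondDeriv u g)
    (hE : energy J u g = 0) :
    ∃ v v1 v2 v3 : ℝ → ℝ, IsSolution J v v1 v2 v3 ∧ u =ᵐ[volume] v ∧ g =ᵐ[volume] v2 := by
  obtain ⟨v, v1, hv, -, hv1, huv⟩ := hw.exists_C1
  have hvc : Continuous v := continuous_iff_continuousAt.2 fun x => (hv x).continuousAt
  obtain ⟨V, W, hV, -, hWi, hVe⟩ := (hJ.isWeakSecondDeriv (hu.ae_eq huv) hg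
    (hw.congr huv (ae_eq_refl g)) ((energy_congr J huv (ae_eq_refl g)).symm.trans hE)
    hvc).exists_C1
  have hVc : Continuous V := continuous_iff_continuousAt.2 fun x => (hV x).continuousAt
  -- `V` is the `C¹` representative of `2 g - v²`; solving for `g` gives a `C¹` representative of
  -- the second derivative.
  set v2 : ℝ → ℝ := fun x => (V x + v x ^ 2) / 2 with hv2
  have hv2c : Continuous v2 := by fun_prop
  have hgv : g =ᵐ[volume] v2 := by
    filter_upwards [hVe] with x hx
    simp only [hv2, ← hx]
    ring
  have d1 : ∀ x, HasDerivAt v1 (v2 x) x := hasDerivAt_of_integral_eq_sub hv2c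
    fun x y => (hv1 x y).trans (intervalIntegral.integral_congr_ae (hgv.mono fun t ht _ => ht))
  have dW : ∀ x, HasDerivAt W (2 * (v2 x * v x) - 4 * J * v x ^ 3) x :=
    hasDerivAt_of_integral_eq_sub (by fun_prop) fun x y => (hWi x y).trans
      (intervalIntegral.integral_congr_ae (hgv.mono fun t ht _ => by simp only [ht]))
  refine ⟨v, v1, v2, fun x => (W x + 2 * v x * v1 x) / 2, ⟨hv, d1, fun x => ?_, fun x => ?_⟩,
    huv, hgv⟩
  · refine (((hV x).fun_add ((hv x).fun_pow 2)).div_const 2).congr_deriv ?_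
    norm_num
  · refine (((dW x).fun_add (((hv x).const_mul 2).fun_mul (d1 x))).div_const 2).congr_deriv ?_
    ring

/-! ### Decay at infinity. -/

theorem tendsto_integral_unit_interval_atTop {f : ℝ → ℝ} (hf : Integrable f) :
    Tendsto (fun x => ∫ t in x..(x + 1), f t) atTop (𝓝 0) := by
  have h1 := intervalIntegral_tendsto_integral_Ioi 0 hf.integrableOn tendsto_id
  have h2 := intervalIntegral_tendsto_integral_Ioi 0 hf.integrableOn
    (tendsto_atTop_add_const_right atTop (1 : ℝ) tendsto_id)
  have h3 := h2.sub h1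
  rw [sub_self] at h3
  refine h3.congr fun x => ?_
  exact intervalIntegral.integral_interval_sub_left hf.intervalIntegrable hf.intervalIntegrable

theorem tendsto_integral_unit_interval_atBot {f : ℝ → ℝ} (hf : Integrable f) :
    Tendsto (fun x => ∫ t in x..(x + 1), f t) atBot (𝓝 0) := by
  have h1 := intervalIntegral_tendsto_integral_Iic 0 hf.integrableOn tendsto_id
  have h2 := intervalIntegral_tendsto_integral_Iic 0 hf.integrableOn
    (tendsto_atBot_add_const_right atBot (1 : ℝ) tendsto_id)
  have h3 := h1.sub h2
  rw [sub_self] at h3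
  refine h3.congr fun x => ?_
  rw [sub_eq_iff_eq_add]
  exact (intervalIntegral.integral_add_adjacent_intervals hf.intervalIntegrable
    hf.intervalIntegrable).symm

/-- Trades a pointwise value for a small constant plus an integrable quantity, which replaces
Hölder's inequality on unit intervals. -/
theorem abs_le_add_pow_four {ε : ℝ} (hε : 0 < ε) (y : ℝ) : |y| ≤ ε + y ^ 4 / ε ^ 3 := by
  rcases le_total |y| ε with h | h
  · have : 0 ≤ y ^ 4 / ε ^ 3 := div_nonneg (by positivity) (by positivity)
    linarith
  · have h1 : |y| ≤ y ^ 4 / ε ^ 3 := by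
      rw [le_div_iff₀ (by positivity), ← (show Even 4 by decide).pow_abs, pow_succ' |y| 3]
      gcongr
    linarith

theorem abs_le_add_sq {ε : ℝ} (hε : 0 < ε) (y : ℝ) : |y| ≤ ε + y ^ 2 / ε := by
  rcases le_total |y| ε with h | h
  · have : 0 ≤ y ^ 2 / ε := by positivity
    linarith
  · have h1 : |y| ≤ y ^ 2 / ε := by
      rw [le_div_iff₀ hε, ← sq_abs, sq]
      gcongr
    linarith

section Decay

variable {u u1 u2 : ℝ → ℝ} (h0 : ∀ x, HasDerivAt u (u1 x) x) (h1 : ∀ x, HasDerivAt u1 (u2 x) x)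
  (hc : Continuous u2) (hu : MemLp u 4 volume) (hg : MemLp u2 2 volume)

include h0 h1 hc in
/-- Representation of boundary values on `[x, x + 1]` by a cubic weight
`α + β s + γ s² + δ s³`. -/
theorem abs_boundary_le {ε : ℝ} (hε : 0 < ε) {α β γ δ : ℝ}
    (hA : ∀ s ∈ Icc (0 : ℝ) 1, |α + β * s + γ * s ^ 2 + δ * s ^ 3| ≤ 1)
    (hA2 : ∀ s ∈ Icc (0 : ℝ) 1, |2 * γ + 6 * δ * s| ≤ 6)
    (e1 : α + β + γ + δ = 0) (e2 : β + 2 * γ + 3 * δ = 0) (x : ℝ) :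
    |α * u1 x - β * u x|
      ≤ 7 * ε + (1 / ε + 6 / ε ^ 3) * ∫ t in x..(x + 1), (u t ^ 4 + u2 t ^ 2) := by
  have cu : Continuous u := continuous_iff_continuousAt.2 fun x => (h0 x).continuousAt
  -- With `A` the cubic weight, `G = A u' - A' u` and `G' = A u'' - A'' u`. Hypotheses `e1` and `e2`
  -- say that `A` and `A'` vanish at `s = 1`, so only the boundary term at `x` survives.
  set G : ℝ → ℝ := fun t => (α + β * (t - x) + γ * (t - x) ^ 2 + δ * (t - x) ^ 3) * u1 t
    - (β + 2 * γ * (t - x) + 3 * δ * (t - x) ^ 2) * u t with hG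
  set G' : ℝ → ℝ := fun t => (α + β * (t - x) + γ * (t - x) ^ 2 + δ * (t - x) ^ 3) * u2 t
    - (2 * γ + 6 * δ * (t - x)) * u t with hG'
  have dG : ∀ t, HasDerivAt G (G' t) t := fun t => by
    have ds : HasDerivAt (fun t => t - x) 1 t := (hasDerivAt_id t).sub_const x
    have dA := (((ds.const_mul β).const_add α).fun_add ((ds.fun_pow 2).const_mul γ)).fun_add
      ((ds.fun_pow 3).const_mul δ)
    have dB := ((ds.const_mul (2 * γ)).const_add β).fun_add ((ds.fun_pow 2).const_mul (3 * δ))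
    refine ((dA.fun_mul (h1 t)).fun_sub (dB.fun_mul (h0 t))).congr_deriv ?_
    simp only [hG']
    push_cast
    ring
  have cG' : Continuous G' := by fun_prop
  have hint := intervalIntegral.integral_eq_sub_of_hasDerivAt (a := x) (b := x + 1)
    (fun t _ => dG t) (cG'.intervalIntegrable _ _)
  have g1 : G (x + 1) = 0 := by
    simp only [hG, add_sub_cancel_left, one_pow, mul_one]
    rw [e1, show β + 2 * γ + 3 * δ = 0 from e2]; ring
  have g0 : G x = α * u1 x - β * u x := by simp [hG]
  have hb : ∀ t ∈ Icc x (x + 1),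
      |G' t| ≤ 7 * ε + (1 / ε + 6 / ε ^ 3) * (u t ^ 4 + u2 t ^ 2) := fun t ht => by
    have hs : t - x ∈ Icc (0 : ℝ) 1 := ⟨by linarith [ht.1], by linarith [ht.2]⟩
    have a1 : |G' t| ≤ 1 * |u2 t| + 6 * |u t| := by
      refine (abs_sub _ _).trans ?_
      rw [abs_mul, abs_mul]
      exact add_le_add (mul_le_mul_of_nonneg_right (hA _ hs) (abs_nonneg _))
        (mul_le_mul_of_nonneg_right (hA2 _ hs) (abs_nonneg _))
    have a2 := abs_le_add_pow_four hε (u t)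
    have a3 := abs_le_add_sq hε (u2 t)
    have a4 : 0 ≤ 1 / ε * u t ^ 4 := by positivity
    have a5 : 0 ≤ 6 / ε ^ 3 * u2 t ^ 2 := by positivity
    calc |G' t| ≤ 1 * |u2 t| + 6 * |u t| := a1
      _ ≤ (ε + u2 t ^ 2 / ε) + 6 * (ε + u t ^ 4 / ε ^ 3) := by linarith
      _ = 7 * ε + 1 / ε * u2 t ^ 2 + 6 / ε ^ 3 * u t ^ 4 := by ring
      _ ≤ _ := by linarith
  have hle := intervalIntegral.norm_integral_le_of_norm_le (μ := volume) (f := G')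
    (g := fun t => 7 * ε + (1 / ε + 6 / ε ^ 3) * (u t ^ 4 + u2 t ^ 2)) (a := x) (b := x + 1)
    (by linarith) (ae_of_all _ fun t ht => hb t ⟨ht.1.le, ht.2⟩)
    (Continuous.intervalIntegrable (by fun_prop) _ _)
  rw [hint, g1, g0, zero_sub, norm_neg, intervalIntegral.integral_add (by simp)
    (Continuous.intervalIntegrable (by fun_prop) _ _), intervalIntegral.integral_const_mul] at hle
  simpa using hle

include h0 h1 hc in
theorem tendsto_zero_of_tendsto_integral {l : Filter ℝ}
    (hl : Tendsto (fun x => ∫ t in x..(x + 1), (u t ^ 4 + u2 t ^ 2)) l (𝓝 0)) :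
    Tendsto u l (𝓝 0) ∧ Tendsto u1 l (𝓝 0) := by
  have aux : ∀ {f : ℝ → ℝ}, (∀ ε > 0, ∀ x, |f x|
      ≤ 7 * ε + (1 / ε + 6 / ε ^ 3) * ∫ t in x..(x + 1), (u t ^ 4 + u2 t ^ 2)) →
      Tendsto f l (𝓝 0) := fun {f} hf => by
    rw [Metric.tendsto_nhds]
    intro r hr
    -- For `ε = r / 14` the constant term `7 ε` is `r / 2`; the integral term supplies the other
    -- half.
    have := hl.const_mul (1 / (r / 14) + 6 / (r / 14) ^ 3)
    rw [mul_zero] at this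
    filter_upwards [this.eventually_lt_const (half_pos hr)] with x hx
    rw [Real.dist_eq, sub_zero]
    linarith [hf (r / 14) (by positivity) x]
  constructor
  · refine aux fun ε hε x => ?_
    -- The weight `-s (1 - s)²` has value 0 and slope -1 at `s = 0`, isolating `u x`.
    have := abs_boundary_le h0 h1 hc hε (α := 0) (β := -1) (γ := 2) (δ := -1)
      (fun s hs => by
        rw [abs_le]
        have e : 0 + -1 * s + 2 * s ^ 2 + -1 * s ^ 3 = -(s * (1 - s) ^ 2) := by ring
        rw [e]
        have p1 : 0 ≤ s * (1 - s) ^ 2 := mul_nonneg hs.1 (sq_nonneg _)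
        have p2 : s * (1 - s) ^ 2 ≤ 1 * 1 ^ 2 := by
          have := hs.1
          have := hs.2
          gcongr
          linarith
        constructor <;> linarith)
      (fun s hs => by rw [abs_le]; constructor <;> linarith [hs.1, hs.2])
      (by norm_num) (by norm_num) x
    simpa using this
  · refine aux fun ε hε x => ?_
    -- The weight `(1 - s)² (1 + 2 s)` has value 1 and slope 0 at `s = 0`, isolating `u1 x`.
    have := abs_boundary_le h0 h1 hc hε (α := 1) (β := 0) (γ := -3) (δ := 2)
      (fun s hs => by
        have e : 1 + 0 * s + -3 * s ^ 2 + 2 * s ^ 3 = (1 - s) ^ 2 * (1 + 2 * s) := by ring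
        rw [abs_le]
        have p1 : 0 ≤ (1 - s) ^ 2 * (1 + 2 * s) := mul_nonneg (sq_nonneg _) (by linarith [hs.1])
        have p2 : 0 ≤ s ^ 2 * (3 - 2 * s) := mul_nonneg (sq_nonneg _) (by linarith [hs.2])
        constructor
        · rw [e]; linarith
        · linarith)
      (fun s hs => by rw [abs_le]; constructor <;> linarith [hs.1, hs.2])
      (by norm_num) (by norm_num) x
    simpa using this

include h0 h1 hc hu hg in
theorem tendsto_zero_atTop : Tendsto u atTop (𝓝 0) ∧ Tendsto u1 atTop (𝓝 0) :=
  tendsto_zero_of_tendsto_integral h0 h1 hc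
    (tendsto_integral_unit_interval_atTop (hu.integrable_pow_four.add hg.integrable_sq))

include h0 h1 hc hu hg in
theorem tendsto_zero_atBot : Tendsto u atBot (𝓝 0) ∧ Tendsto u1 atBot (𝓝 0) :=
  tendsto_zero_of_tendsto_integral h0 h1 hc
    (tendsto_integral_unit_interval_atBot (hu.integrable_pow_four.add hg.integrable_sq))

end Decay

/-! ### Uniqueness for the equation and its conserved quantity. -/

namespace IsSolution

variable {J : ℝ} {u u1 u2 u3 w w1 w2 w3 : ℝ → ℝ}

theorem continuous0 (h : IsSolution J u u1 u2 u3) : Continuous u :=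
  continuous_iff_continuousAt.2 fun x => (h.deriv0 x).continuousAt

theorem continuous1 (h : IsSolution J u u1 u2 u3) : Continuous u1 :=
  continuous_iff_continuousAt.2 fun x => (h.deriv1 x).continuousAt

theorem continuous2 (h : IsSolution J u u1 u2 u3) : Continuous u2 :=
  continuous_iff_continuousAt.2 fun x => (h.deriv2 x).continuousAt

theorem continuous3 (h : IsSolution J u u1 u2 u3) : Continuous u3 :=
  continuous_iff_continuousAt.2 fun x => (h.deriv3 x).continuousAt

/-- Solutions with the same Cauchy data coincide. -/
theorem eq_of_cauchy_data (hu : IsSolution J u u1 u2 u3) (hw : IsSolution J w w1 w2 w3) {c : ℝ}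
    (e0 : u c = w c) (e1 : u1 c = w1 c) (e2 : u2 c = w2 c) (e3 : u3 c = w3 c) : u = w := by
  let F : ℝ × ℝ × ℝ × ℝ → ℝ × ℝ × ℝ × ℝ := fun p =>
    (p.2.1, p.2.2.1, p.2.2.2, p.2.1 ^ 2 + 2 * p.1 * p.2.2.1 - 2 * J * p.1 ^ 3)
  have hF : ContDiff ℝ 1 F := by fun_prop
  let f : ℝ → ℝ × ℝ × ℝ × ℝ := fun t => (u t, u1 t, u2 t, u3 t)
  let g : ℝ → ℝ × ℝ × ℝ × ℝ := fun t => (w t, w1 t, w2 t, w3 t)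
  have df : ∀ t, HasDerivAt f (F (f t)) t := fun t =>
    (hu.deriv0 t).prodMk ((hu.deriv1 t).prodMk ((hu.deriv2 t).prodMk (hu.deriv3 t)))
  have dg : ∀ t, HasDerivAt g (F (g t)) t := fun t =>
    (hw.deriv0 t).prodMk ((hw.deriv1 t).prodMk ((hw.deriv2 t).prodMk (hw.deriv3 t)))
  have cf : Continuous f := continuous_iff_continuousAt.2 fun x => (df x).continuousAt
  have cg : Continuous g := continuous_iff_continuousAt.2 fun x => (dg x).continuousAt
  -- The vector field is `C¹`, so locally Lipschitz; local uniqueness makes the coincidence set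
  -- open, and connectedness of the line does the rest.
  have hopen : IsOpen {t | f t = g t} := isOpen_iff_mem_nhds.2 fun t (ht : f t = g t) => by
    obtain ⟨K, s, hs, hK⟩ := (hF.contDiffAt (x := f t)).exists_lipschitzOnWith
    refine ODE_solution_unique_of_eventually (v := fun _ => F) (s := fun _ => s) (K := K)
      (Eventually.of_forall fun _ => hK) ?_ ?_ ht
    · filter_upwards [cf.continuousAt.preimage_mem_nhds hs] with r hr
      exact ⟨df r, hr⟩
    · filter_upwards [cg.continuousAt.preimage_mem_nhds (ht ▸ hs)] with r hr
      exact ⟨dg r, hr⟩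
  have huniv := IsClopen.eq_univ ⟨isClosed_eq cf cg, hopen⟩
    ⟨c, by simp only [mem_ofPred_eq, f, g, e0, e1, e2, e3]⟩
  ext t
  have : t ∈ {t | f t = g t} := by rw [huniv]; trivial
  exact congrArg Prod.fst this

/-- The Hamiltonian vanishes along solutions of finite energy. -/
theorem hamiltonian_eq_zero (h : IsSolution J u u1 u2 u3) (hu : MemLp u 4 volume)
    (hg : MemLp u2 2 volume) (x : ℝ) :
    -2 * u3 x * u1 x + 2 * u x * u1 x ^ 2 + u2 x ^ 2 - J * u x ^ 4 = 0 := by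
  set H : ℝ → ℝ := fun x => -2 * u3 x * u1 x + 2 * u x * u1 x ^ 2 + u2 x ^ 2 - J * u x ^ 4
  have dH : ∀ x, HasDerivAt H 0 x := fun x => by
    refine ((((((h.deriv3 x).const_mul (-2)).fun_mul (h.deriv1 x)).fun_add
      (((h.deriv0 x).const_mul 2).fun_mul ((h.deriv1 x).fun_pow 2))).fun_add
      ((h.deriv2 x).fun_pow 2)).fun_sub (((h.deriv0 x).fun_pow 4).const_mul J)).congr_deriv ?_
    push_cast
    ring
  have hconst : ∀ y, H y = H x := fun y =>
    is_const_of_deriv_eq_zero (fun z => (dH z).differentiableAt) (fun z => (dH z).deriv) y x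
  by_contra hne
  change H x ≠ 0 at hne
  have c0 := h.continuous0
  have c1 := h.continuous1
  have c2 := h.continuous2
  have c3 := h.continuous3
  -- Below, `S' = H - k` with `k` integrable. A nonzero constant `H` would make `S` grow linearly.
  set k : ℝ → ℝ := fun x => 3 * u2 x ^ 2 - u2 x * u x ^ 2 - J * u x ^ 4 with hk
  have ki : Integrable k := ((hg.integrable_sq.const_mul 3).sub (integrable_mul_sq hu hg)).sub
    (hu.integrable_pow_four.const_mul J)
  set S : ℝ → ℝ := fun x => u1 x * (u x ^ 2 - 2 * u2 x) with hS
  have dS : ∀ y, HasDerivAt S (H x - k y) y := fun y => by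
    refine ((h.deriv1 y).fun_mul (((h.deriv0 y).fun_pow 2).fun_sub
      ((h.deriv2 y).const_mul 2))).congr_deriv ?_
    rw [← hconst y]
    simp only [hk, H]
    push_cast
    ring
  have hgrow : ∀ b, 0 ≤ b → |H x| * b - (∫ t, |k t|) - |S 0| ≤ |S b| := fun b hb => by
    have e := intervalIntegral.integral_eq_sub_of_hasDerivAt (a := 0) (b := b)
      (fun t _ => dS t) (Continuous.intervalIntegrable (by fun_prop) _ _)
    rw [intervalIntegral.integral_sub (by simp) ki.intervalIntegrable,
      intervalIntegral.integral_const, sub_zero, smul_eq_mul] at e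
    have e2 : |∫ t in (0 : ℝ)..b, k t| ≤ ∫ t, |k t| := by
      refine (intervalIntegral.norm_integral_le_integral_norm_uIoc (f := k)).trans ?_
      exact setIntegral_le_integral ki.norm (ae_of_all _ fun t => norm_nonneg _)
    have e3 : b * H x = S b + (∫ t in (0 : ℝ)..b, k t) - S 0 := by linarith
    have e4 : |H x| * b = |b * H x| := by rw [abs_mul, abs_of_nonneg hb, mul_comm]
    rw [e4, e3]
    have := abs_sub (S b + ∫ t in (0 : ℝ)..b, k t) (S 0)
    have := abs_add_le (S b) (∫ t in (0 : ℝ)..b, k t)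
    linarith
  have hbd : ∀ᶠ b in atTop, |u1 b| ≤ 1 := by
    filter_upwards [(tendsto_zero_atTop h.deriv0 h.deriv1 c2 hu hg).2.abs.eventually_le_const
      (by simp : |(0 : ℝ)| < 1)] with b hb using hb
  have hlarge : ∀ᶠ b : ℝ in atTop, 1 ≤ |S b| := by
    have : Tendsto (fun b : ℝ => |H x| * b) atTop atTop :=
      tendsto_id.const_mul_atTop (abs_pos.2 hne)
    filter_upwards [this.eventually_ge_atTop (1 + (∫ t, |k t|) + |S 0|), eventually_ge_atTop 0]
      with b hb hb0
    linarith [hgrow b hb0]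
  obtain ⟨N, hN⟩ := eventually_atTop.1 (hbd.and hlarge)
  -- Eventually `|u1| ≤ 1 ≤ |S|`, so `1 ≤ (u² - 2 u2)² ≤ 2 u⁴ + 8 u2²` on a half-line, which is
  -- impossible for an integrable right side.
  have hi : Integrable fun b => 8 * u2 b ^ 2 + 2 * u b ^ 4 :=
    (hg.integrable_sq.const_mul 8).add (hu.integrable_pow_four.const_mul 2)
  have h1 : IntegrableOn (fun _ : ℝ => (1 : ℝ)) (Ici N) := by
    refine Integrable.mono' hi.integrableOn aestronglyMeasurable_const ?_
    refine (ae_restrict_iff' measurableSet_Ici).2 (ae_of_all _ fun b hb => ?_)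
    obtain ⟨p, q⟩ := hN b hb
    have r : 1 ≤ |u b ^ 2 - 2 * u2 b| := by
      rw [hS, abs_mul] at q
      exact q.trans (mul_le_of_le_one_left (abs_nonneg _) p)
    have r2 : 1 ≤ (u b ^ 2 - 2 * u2 b) ^ 2 := by
      rw [← sq_abs]; exact one_le_pow₀ r
    rw [norm_one]
    nlinarith [sq_nonneg (u b ^ 2 + 2 * u2 b)]
  rw [integrableOn_const_iff] at h1
  simp at h1

end IsSolution

/-! ### Even reflection and symmetry about critical points. -/

/-- Precomposition with `fold c` reflects a function on `[c, ∞)` evenly about `c`. -/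
def fold (c x : ℝ) : ℝ := c + |x - c|

theorem fold_of_le {c x : ℝ} (h : c ≤ x) : fold c x = x := by
  rw [fold, abs_of_nonneg (by linarith)]; ring

theorem fold_of_ge {c x : ℝ} (h : x ≤ c) : fold c x = 2 * c - x := by
  rw [fold, abs_of_nonpos (by linarith)]; ring

theorem continuous_fold (c : ℝ) : Continuous (fold c) := by
  unfold fold
  fun_prop

theorem comp_fold_eq_indicator_add (c : ℝ) (f : ℝ → ℝ) :
    (fun x => f (fold c x))
      = (Ioi c).indicator f + (Iic c).indicator (fun x => f (2 * c - x)) := by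
  ext x
  rcases le_or_gt x c with h | h
  · simp [h, not_lt.2 h, fold_of_ge h]
  · simp [h, not_le.2 h, fold_of_le h.le]

theorem memLp_comp_reflect {p : ENNReal} (c : ℝ) {f : ℝ → ℝ} (hf : MemLp f p volume) :
    MemLp (fun x => f (2 * c - x)) p volume :=
  hf.comp_measurePreserving (Measure.measurePreserving_sub_left volume (2 * c))

theorem memLp_comp_fold {p : ENNReal} (c : ℝ) {f : ℝ → ℝ} (hf : MemLp f p volume) :
    MemLp (fun x => f (fold c x)) p volume := by
  rw [comp_fold_eq_indicator_add]
  exact (hf.indicator measurableSet_Ioi).add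
    ((memLp_comp_reflect c hf).indicator measurableSet_Iic)

theorem setIntegral_Iic_comp_reflect (c : ℝ) (f : ℝ → ℝ) :
    ∫ x in Iic c, f (2 * c - x) = ∫ x in Ioi c, f x := by
  have h := (Measure.measurePreserving_sub_left (volume : Measure ℝ) (2 * c)).setIntegral_preimage_emb
    (Homeomorph.subLeft (2 * c)).measurableEmbedding f (Ici c)
  rw [integral_Ici_eq_integral_Ioi] at h
  rw [← h]
  congr 2
  ext x
  simp only [mem_Iic, mem_preimage, mem_Ici]
  constructor <;> intro <;> linarith

theorem integral_comp_fold (c : ℝ) {f : ℝ → ℝ} (hf : Integrable f) :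
    ∫ x, f (fold c x) = 2 * ∫ x in Ioi c, f x := by
  have hi : Integrable fun x => f (fold c x) := by
    rw [← memLp_one_iff_integrable] at hf ⊢
    exact memLp_comp_fold c hf
  rw [← intervalIntegral.integral_Iic_add_Ioi (b := c) hi.integrableOn hi.integrableOn,
    setIntegral_congr_fun measurableSet_Iic
      (fun x hx => by simp only [fold_of_ge (mem_Iic.1 hx)] : EqOn (fun x => f (fold c x)) (fun x => f (2 * c - x)) _),
    setIntegral_congr_fun measurableSet_Ioi
      (fun x hx => by simp only [fold_of_le (le_of_lt (mem_Ioi.1 hx))] : EqOn (fun x => f (fold c x)) f _),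
    setIntegral_Iic_comp_reflect]
  ring

theorem HasCompactSupport.tendsto_atTop_zero {f : ℝ → ℝ} (hf : HasCompactSupport f) :
    Tendsto f atTop (𝓝 0) := by
  rw [hasCompactSupport_iff_eventuallyEq, Filter.coclosedCompact_eq_cocompact] at hf
  exact (hf.filter_mono atTop_le_cocompact).tendsto

section Fold

variable {u u1 u2 : ℝ → ℝ} (h0 : ∀ x, HasDerivAt u (u1 x) x) (h1 : ∀ x, HasDerivAt u1 (u2 x) x)
  (hc : Continuous u2)

include h0 h1 hc in
theorem setIntegral_Ioi_weak_deriv (c : ℝ) {φ : ℝ → ℝ} (hφ : ContDiff ℝ ∞ φ)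
    (hs : HasCompactSupport φ) :
    ∫ x in Ioi c, (u x * deriv (deriv φ) x - u2 x * φ x) = u1 c * φ c - u c * deriv φ c := by
  have cu : Continuous u := continuous_iff_continuousAt.2 fun x => (h0 x).continuousAt
  have hφ' := contDiff_deriv_test hφ
  have c2 := hφ'.continuous_deriv (by simp)
  have d : ∀ x, HasDerivAt (fun x => u x * deriv φ x - u1 x * φ x)
      (u x * deriv (deriv φ) x - u2 x * φ x) x := fun x => by
    refine (((h0 x).fun_mul (hφ'.differentiable (by simp) x).hasDerivAt).fun_sub
      ((h1 x).fun_mul (hφ.differentiable (by simp) x).hasDerivAt)).congr_deriv ?_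
    ring
  have hcs : HasCompactSupport fun x => u x * deriv φ x - u1 x * φ x :=
    hs.deriv.mul_left.sub hs.mul_left
  rw [integral_Ioi_of_hasDerivAt_of_tendsto' (fun x _ => d x) ?_ hcs.tendsto_atTop_zero]
  · ring
  · exact ((cu.locallyIntegrable.integrable_mul_of_hasCompactSupport c2 hs.deriv.deriv).sub
      (hc.locallyIntegrable.integrable_mul_of_hasCompactSupport hφ.continuous hs)).integrableOn

include h0 h1 hc in
/-- The even reflection about a critical point is twice weakly differentiable. -/
theorem isWeakSecondDeriv_comp_fold {c : ℝ} (h : u1 c = 0) :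
    IsWeakSecondDeriv (fun x => u (fold c x)) (fun x => u2 (fold c x)) := by
  have cu : Continuous u := continuous_iff_continuousAt.2 fun x => (h0 x).continuousAt
  have l1 := (cu.comp (continuous_fold c)).locallyIntegrable (μ := volume)
  have l2 := (hc.comp (continuous_fold c)).locallyIntegrable (μ := volume)
  refine ⟨l1, l2, fun φ hφ hs => ?_⟩
  have c2 := (contDiff_deriv_test hφ).continuous_deriv (by simp)
  have i1 := l1.integrable_mul_of_hasCompactSupport c2 hs.deriv.deriv
  have i2 := l2.integrable_mul_of_hasCompactSupport hφ.continuous hs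
  have r0 : ∀ x, HasDerivAt (fun x => u (2 * c - x)) (-u1 (2 * c - x)) x := fun x => by
    simpa using (h0 (2 * c - x)).comp_const_sub (2 * c) x
  have r1 : ∀ x, HasDerivAt (fun x => -u1 (2 * c - x)) (u2 (2 * c - x)) x := fun x => by
    simpa using ((h1 (2 * c - x)).comp_const_sub (2 * c) x).fun_neg
  have rc : Continuous fun x => u2 (2 * c - x) := by fun_prop
  -- When the two half-lines are added, the terms `u c * deriv φ c` cancel and the slopes leave `2 *
  -- u1 c * φ c`, which is zero by `h`.
  have k1 := setIntegral_Ioi_weak_deriv h0 h1 hc c hφ hs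
  have k2 := setIntegral_Ioi_weak_deriv r0 r1 rc c hφ hs
  have j : Integrable fun x => u (2 * c - x) * deriv (deriv φ) x - u2 (2 * c - x) * φ x :=
    ((by fun_prop : Continuous fun x => u (2 * c - x)).locallyIntegrable
      |>.integrable_mul_of_hasCompactSupport c2 hs.deriv.deriv).sub
      (rc.locallyIntegrable.integrable_mul_of_hasCompactSupport hφ.continuous hs)
  have k3 := intervalIntegral.integral_Iic_add_Ioi (b := c) j.integrableOn j.integrableOn
  have k4 : ∫ x, (u (2 * c - x) * deriv (deriv φ) x - u2 (2 * c - x) * φ x) = 0 := by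
    have w := isWeakSecondDeriv_of_hasDerivAt r0 r1 rc
    rw [integral_sub (w.locallyIntegrable.integrable_mul_of_hasCompactSupport c2 hs.deriv.deriv)
      (w.locallyIntegrable_deriv.integrable_mul_of_hasCompactSupport hφ.continuous hs),
      w.integral_eq φ hφ hs, sub_self]
  have i3 : Integrable fun x =>
      u (fold c x) * deriv (deriv φ) x - u2 (fold c x) * φ x := i1.sub i2
  have key : ∫ x, (u (fold c x) * deriv (deriv φ) x - u2 (fold c x) * φ x) = 0 := by
    rw [← intervalIntegral.integral_Iic_add_Ioi (b := c) i3.integrableOn i3.integrableOn,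
      setIntegral_congr_fun measurableSet_Iic (fun x hx => by simp only [fold_of_ge (mem_Iic.1 hx)] :
        EqOn (fun x => u (fold c x) * deriv (deriv φ) x - u2 (fold c x) * φ x)
          (fun x => u (2 * c - x) * deriv (deriv φ) x - u2 (2 * c - x) * φ x) _),
      setIntegral_congr_fun measurableSet_Ioi (fun x hx => by simp only [fold_of_le (le_of_lt (mem_Ioi.1 hx))] :
        EqOn (fun x => u (fold c x) * deriv (deriv φ) x - u2 (fold c x) * φ x)
          (fun x => u x * deriv (deriv φ) x - u2 x * φ x) _), k1]
    have e : 2 * c - c = c := by ring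
    simp only [e, h] at k2 ⊢
    linarith
  exact sub_eq_zero.1 ((integral_sub i1 i2).symm.trans key)

end Fold

theorem energy_comp_fold (J c : ℝ) {u g : ℝ → ℝ} (hu : MemLp u 4 volume) (hg : MemLp g 2 volume) :
    energy J (fun x => u (fold c x)) (fun x => g (fold c x))
      = 2 * ∫ x in Ioi c, (g x ^ 2 - g x * u x ^ 2 + J * u x ^ 4) :=
  integral_comp_fold c (integrable_energy_density J hu hg)

/-- Continuity carries the equality of derivatives to the endpoint `c`; iterating it matches all
Cauchy data there. -/
theorem eqOn_Ici_deriv {f g f' g' : ℝ → ℝ} {c : ℝ} (hf : ∀ x, HasDerivAt f (f' x) x)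
    (hg : ∀ x, HasDerivAt g (g' x) x) (cf : Continuous f') (cg : Continuous g')
    (h : EqOn f g (Ici c)) : EqOn f' g' (Ici c) := by
  have h1 : EqOn f' g' (Ioi c) := fun x hx => by
    refine (hf x).unique ((hg x).congr_of_eventuallyEq ?_)
    filter_upwards [Ioi_mem_nhds hx] with y hy using h (mem_Ici.2 (le_of_lt hy))
  rw [← closure_Ioi]
  exact h1.closure cf cg

/-- A solution with zero energy is symmetric about each of its critical points. -/
theorem IsSolution.symmetric {J : ℝ} {u u1 u2 u3 : ℝ → ℝ} (h : IsSolution J u u1 u2 u3)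
    (hJ : EnergyNonneg J) (hu : MemLp u 4 volume) (hg : MemLp u2 2 volume)
    (hE : energy J u u2 = 0) {c : ℝ} (hc : u1 c = 0) (x : ℝ) : u (2 * c - x) = u x := by
  have i0 := integrable_energy_density J hu hg
  have hwR := isWeakSecondDeriv_comp_fold h.deriv0 h.deriv1 h.continuous2 hc
  have eR := hJ _ _ (memLp_comp_fold c hu) (memLp_comp_fold c hg) hwR
  -- The left half is handled by first reflecting `u` about `c` and then folding.
  have hwL := isWeakSecondDeriv_comp_fold (u := fun x => u (2 * c - x))
    (u1 := fun x => -u1 (2 * c - x)) (u2 := fun x => u2 (2 * c - x)) (c := c)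
    (fun x => by simpa using (h.deriv0 (2 * c - x)).comp_const_sub (2 * c) x)
    (fun x => by simpa using ((h.deriv1 (2 * c - x)).comp_const_sub (2 * c) x).fun_neg)
    (h.continuous2.comp (by fun_prop : Continuous fun x => 2 * c - x))
    (by simp only [show 2 * c - c = c by ring, hc, neg_zero])
  have mu := memLp_comp_reflect c hu
  have mg := memLp_comp_reflect c hg
  have eL := hJ _ _ (memLp_comp_fold c mu) (memLp_comp_fold c mg) hwL
  rw [energy_comp_fold J c mu mg, ← setIntegral_Iic_comp_reflect] at eL
  simp only [sub_sub_cancel] at eL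
  have esum := intervalIntegral.integral_Iic_add_Ioi (b := c) i0.integrableOn i0.integrableOn
  have eR0 : energy J (fun x => u (fold c x)) (fun x => u2 (fold c x)) = 0 := by
    refine le_antisymm ?_ eR
    rw [energy_comp_fold J c hu hg]
    rw [energy] at hE
    linarith
  -- The folded function is itself a zero of the energy, so it is a classical solution across `c`.
  obtain ⟨v, v1, v2, v3, hv, huv, -⟩ :=
    hJ.exists_isSolution (memLp_comp_fold c hu) (memLp_comp_fold c hg) hwR eR0
  have hfold : (fun x => u (fold c x)) = v :=
    (Continuous.ae_eq_iff_eq volume (h.continuous0.comp (continuous_fold c)) hv.continuous0).1 huv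
  have q0 : EqOn u v (Ici c) := fun y hy => by
    rw [← hfold]
    simp only [fold_of_le (show c ≤ y from hy)]
  have q1 := eqOn_Ici_deriv h.deriv0 hv.deriv0 h.continuous1 hv.continuous1 q0
  have q2 := eqOn_Ici_deriv h.deriv1 hv.deriv1 h.continuous2 hv.continuous2 q1
  have q3 := eqOn_Ici_deriv h.deriv2 hv.deriv2 h.continuous3 hv.continuous3 q2
  have huv' : u = v := h.eq_of_cauchy_data hv (q0 self_mem_Ici) (q1 self_mem_Ici)
    (q2 self_mem_Ici) (q3 self_mem_Ici)
  have e : ∀ y, u y = u (fold c y) := fun y => by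
    rw [← huv'] at hfold
    exact (congrFun hfold y).symm
  rw [e (2 * c - x), e x, fold, fold, show 2 * c - x - c = -(x - c) by ring, abs_neg]

/-! ### Excluding both monotone profiles. -/

theorem pos_or_neg_of_ne_zero {f : ℝ → ℝ} (hf : Continuous f) {c : ℝ}
    (h : ∀ x, c < x → f x ≠ 0) : (∀ x, c < x → 0 < f x) ∨ ∀ x, c < x → f x < 0 := by
  by_contra! hn
  obtain ⟨⟨x, hx, hfx⟩, y, hy, hfy⟩ := hn
  obtain ⟨z, hz, hz0⟩ := intermediate_value_uIcc (hf.continuousOn (s := uIcc x y))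
    (show (0 : ℝ) ∈ uIcc (f x) (f y) from Icc_subset_uIcc ⟨hfx, hfy⟩)
  exact h z ((lt_min hx hy).trans_le hz.1) hz0

theorem add_mul_le_of_le_deriv {f f' : ℝ → ℝ} (hf : ∀ x, HasDerivAt f (f' x) x) {a m : ℝ}
    (h : ∀ x, a ≤ x → m ≤ f' x) {x : ℝ} (hx : a ≤ x) : f a + m * (x - a) ≤ f x := by
  have := (convex_Ici a).mul_sub_le_image_sub_of_le_deriv
    (fun x _ => (hf x).continuousAt.continuousWithinAt)
    (fun x _ => (hf x).differentiableAt.differentiableWithinAt)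
    (fun x hx => by rw [(hf x).deriv]; exact h x (interior_subset hx)) a self_mem_Ici x hx hx
  linarith

theorem exists_pos_of_le_deriv {f f' : ℝ → ℝ} (hf : ∀ x, HasDerivAt f (f' x) x) {a m : ℝ}
    (hm : 0 < m) (h : ∀ x, a ≤ x → m ≤ f' x) : ∃ x, a ≤ x ∧ 0 < f x := by
  have hx : a ≤ a + (|f a| + 1) / m := by
    have : 0 ≤ (|f a| + 1) / m := by positivity
    linarith
  refine ⟨_, hx, ?_⟩
  have := add_mul_le_of_le_deriv hf h hx
  rw [add_sub_cancel_left, mul_div_cancel₀ _ hm.ne'] at this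
  linarith [neg_abs_le (f a)]

namespace IsSolution

variable {J : ℝ} {u u1 u2 u3 : ℝ → ℝ}

/-- No finite-energy solution increases to zero through negative values. -/
theorem not_deriv_pos (h : IsSolution J u u1 u2 u3) (hJ0 : 0 ≤ J) (hu : MemLp u 4 volume)
    (hg : MemLp u2 2 volume) {c : ℝ} (hneg : ∀ x, c < x → u x < 0) :
    ¬ ∀ x, c < x → 0 < u1 x := by
  intro hpos
  -- If `u2 ≥ 0` throughout, `u1` stays above a positive constant and `u` becomes positive.
  obtain ⟨a, ha, hua⟩ : ∃ a, c < a ∧ u2 a < 0 := by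
    by_contra! hn
    have hmono : ∀ x, c + 1 ≤ x → u1 (c + 1) ≤ u1 x := fun x hx => by
      have := add_mul_le_of_le_deriv h.deriv1 (m := 0) (fun y hy => hn y (by linarith)) hx
      linarith
    obtain ⟨x, hx, hx0⟩ := exists_pos_of_le_deriv h.deriv0 (hpos (c + 1) (by linarith)) hmono
    linarith [hneg x (by linarith)]
  -- Barrier argument: at a zero of `u2` the Hamiltonian identity reads `2 u3 u1 = 2 u u1² - J u⁴ <
  -- 0`, so `u3 < 0` and `u2` cannot cross upward.
  have hconc : ∀ x, a ≤ x → u2 x ≤ 0 := fun x hx => by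
    refine image_le_of_deriv_right_lt_deriv_boundary (f := u2) (f' := u3) (a := a) (b := x)
      (B := fun _ => 0) (B' := fun _ => 0) h.continuous2.continuousOn
      (fun y _ => (h.deriv2 y).hasDerivWithinAt) hua.le (fun y => hasDerivAt_const y 0)
      (fun y hy hy0 => ?_) ⟨hx, le_rfl⟩
    have hcy : c < y := ha.trans_le hy.1
    have H := h.hamiltonian_eq_zero hu hg y
    have hy0' : u2 y = 0 := hy0
    have p1 := hpos y hcy
    have p2 : u y * u1 y ^ 2 < 0 := mul_neg_of_neg_of_pos (hneg y hcy) (by positivity)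
    have p3 : 0 ≤ J * u y ^ 4 := mul_nonneg hJ0 (by positivity)
    rw [hy0'] at H
    have p4 : u3 y * u1 y < 0 := by linarith
    exact neg_of_mul_neg_left p4 p1.le
  -- Each term of `u'''' = u1² + 2 u u2 - 2 J u³` is nonnegative here, so `u3` is monotone.
  have hu3 : ∀ x, a ≤ x → ∀ y, x ≤ y → u3 x ≤ u3 y := fun x hx y hy => by
    have := add_mul_le_of_le_deriv h.deriv3 (a := x) (m := 0) (fun z hz => by
      have haz := hx.trans hz
      have q1 : 0 ≤ u z * u2 z :=
        mul_nonneg_of_nonpos_of_nonpos (hneg z (ha.trans_le haz)).le (hconc z haz)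
      have q2 : J * u z ^ 3 ≤ 0 :=
        mul_nonpos_of_nonneg_of_nonpos hJ0
          ((show Odd 3 by decide).pow_nonpos (hneg z (ha.trans_le haz)).le)
      have := sq_nonneg (u1 z)
      linarith) hy
    linarith
  -- A positive value of `u3` eventually makes `u2` positive; otherwise `u2 ≤ u2 a < 0` and `u1`
  -- eventually becomes negative.
  by_cases hex : ∃ b, a ≤ b ∧ 0 < u3 b
  · obtain ⟨b, hb, hb0⟩ := hex
    obtain ⟨x, hx, hx0⟩ := exists_pos_of_le_deriv h.deriv2 hb0 (fun y hy => hu3 b hb y hy)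
    linarith [hconc x (hb.trans hx)]
  · push Not at hex
    have h2 : ∀ x, a ≤ x → -u2 a ≤ -u2 x := fun x hx => by
      have := add_mul_le_of_le_deriv (fun y => (h.deriv2 y).fun_neg) (m := 0)
        (fun y hy => by linarith [hex y hy]) hx
      linarith
    obtain ⟨x, hx, hx0⟩ := exists_pos_of_le_deriv (fun y => (h.deriv1 y).fun_neg)
      (neg_pos.2 hua) h2
    linarith [hpos x (ha.trans_le hx)]

/-- A nonnegative function satisfies `∫ u'' u² ≤ 0`. -/
theorem integral_mul_sq_nonpos (h : IsSolution J u u1 u2 u3) (hu : MemLp u 4 volume)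
    (hg : MemLp u2 2 volume) (hpos : ∀ x, 0 ≤ u x) : ∫ x, u2 x * u x ^ 2 ≤ 0 := by
  have c0 := h.continuous0
  have c1 := h.continuous1
  have c2 := h.continuous2
  obtain ⟨t0, t1⟩ := tendsto_zero_atTop h.deriv0 h.deriv1 c2 hu hg
  obtain ⟨b0, b1⟩ := tendsto_zero_atBot h.deriv0 h.deriv1 c2 hu hg
  have hl := intervalIntegral_tendsto_integral (integrable_mul_sq hu hg) tendsto_neg_atTop_atBot
    tendsto_id
  have e1 := t1.mul (t0.pow 2)
  have e2 := (b1.mul (b0.pow 2)).comp tendsto_neg_atTop_atBot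
  have e3 := e1.sub e2
  have hz : (0 : ℝ) * 0 ^ 2 - 0 * 0 ^ 2 = 0 := by norm_num
  rw [hz] at e3
  refine le_of_tendsto_of_tendsto hl e3 ?_
  filter_upwards [eventually_ge_atTop 0] with R hR
  -- The primitive `u1 u²` has vanishing boundary values at infinity, and the extra term `2 u u1²`
  -- is nonnegative.
  have d : ∀ x, HasDerivAt (fun x => u1 x * u x ^ 2) (u2 x * u x ^ 2 + 2 * (u x * u1 x ^ 2)) x :=
    fun x => by
      refine ((h.deriv1 x).fun_mul ((h.deriv0 x).fun_pow 2)).congr_deriv ?_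
      push_cast
      ring
  have hint := intervalIntegral.integral_eq_sub_of_hasDerivAt (a := -R) (b := R)
    (fun t _ => d t) (Continuous.intervalIntegrable (by fun_prop) _ _)
  rw [intervalIntegral.integral_add (Continuous.intervalIntegrable (by fun_prop) _ _)
    (Continuous.intervalIntegrable (by fun_prop) _ _)] at hint
  have hnn : 0 ≤ ∫ x in (-R)..R, 2 * (u x * u1 x ^ 2) :=
    intervalIntegral.integral_nonneg (by linarith)
      fun x _ => mul_nonneg two_pos.le (mul_nonneg (hpos x) (sq_nonneg _))
  simp only [id, Function.comp]
  linarith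

/-- A nonzero finite-energy solution has a critical point. -/
theorem exists_critical_point (h : IsSolution J u u1 u2 u3) (hu : MemLp u 4 volume)
    (hg : MemLp u2 2 volume) {x₀ : ℝ} (hx₀ : u x₀ ≠ 0) : ∃ c, u1 c = 0 := by
  -- Squaring treats both signs at once: `u²` attains a positive maximum, where `2 u u1 = 0` and `u
  -- ≠ 0`.
  have ht : Tendsto (fun x => u x ^ 2) (cocompact ℝ) (𝓝 0) := by
    rw [cocompact_eq_atBot_atTop]
    have := (tendsto_zero_atBot h.deriv0 h.deriv1 h.continuous2 hu hg).1.sup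
      (tendsto_zero_atTop h.deriv0 h.deriv1 h.continuous2 hu hg).1
    simpa using this.pow 2
  have hp : 0 < u x₀ ^ 2 := by positivity
  obtain ⟨c, hc⟩ := (h.continuous0.pow 2).exists_forall_ge' x₀
    ((ht.eventually_lt_const hp).mono fun x hx => hx.le)
  have hm : IsLocalMax (fun x => u x ^ 2) c := Eventually.of_forall hc
  have hd := hm.hasDerivAt_eq_zero ((h.deriv0 c).fun_pow 2)
  have huc : u c ≠ 0 := fun h0 => by
    have := hc x₀
    simp only [Pi.pow_apply, h0] at this
    linarith
  refine ⟨c, ?_⟩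
  simpa [huc] using hd

/-- A nonzero zero-energy solution has at most one critical point. -/
theorem critical_point_unique (h : IsSolution J u u1 u2 u3) (hJ : EnergyNonneg J)
    (hu : MemLp u 4 volume) (hg : MemLp u2 2 volume) (hE : energy J u u2 = 0) {x₀ : ℝ}
    (hx₀ : u x₀ ≠ 0) {c d : ℝ} (hc : u1 c = 0) (hd : u1 d = 0) : ¬ c < d := by
  intro hcd
  -- Reflections about `c` and `d` compose to a translation by `2 (d - c)`.
  have hper : Function.Periodic u (2 * (d - c)) := fun x => by
    rw [← h.symmetric hJ hu hg hE hc x, ← h.symmetric hJ hu hg hE hd (2 * c - x)]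
    congr 1
    ring
  have hlim : Tendsto (fun n : ℕ => x₀ + n * (2 * (d - c))) atTop atTop :=
    tendsto_atTop_add_const_left _ _
      (tendsto_natCast_atTop_atTop.atTop_mul_const (by linarith))
  have := (tendsto_zero_atTop h.deriv0 h.deriv1 h.continuous2 hu hg).1.comp hlim
  have he : (u ∘ fun n : ℕ => x₀ + n * (2 * (d - c))) = fun _ => u x₀ :=
    funext fun n => hper.nat_mul n x₀
  rw [he] at this
  exact hx₀ (tendsto_nhds_unique tendsto_const_nhds this)

end IsSolution

/-- For `J ≥ 0` a nonnegative `energy J` has no nontrivial zero. -/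
theorem EnergyNonneg.energy_ne_zero {J : ℝ} (hJ : EnergyNonneg J) (hJ0 : 0 ≤ J) {u g : ℝ → ℝ}
    (hug : IsCompetitor u g) : energy J u g ≠ 0 := by
  intro hE'
  obtain ⟨v, v1, v2, v3, h, huv, hgv⟩ :=
    hJ.exists_isSolution hug.memLp_four hug.memLp_two hug.isWeakSecondDeriv hE'
  have hu := hug.memLp_four.ae_eq huv
  have hg := hug.memLp_two.ae_eq hgv
  have hE : energy J v v2 = 0 := (energy_congr J huv hgv).symm.trans hE'
  obtain ⟨x₀, hx₀⟩ : ∃ x, v x ≠ 0 := by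
    by_contra! hn
    exact hug.not_ae_zero (huv.mono fun x hx => hx.trans (hn x))
  obtain ⟨c, hc⟩ := h.exists_critical_point hu hg hx₀
  have hlim := (tendsto_zero_atTop h.deriv0 h.deriv1 h.continuous2 hu hg).1
  rcases pos_or_neg_of_ne_zero h.continuous1 (c := c) fun x hx h0 =>
    h.critical_point_unique hJ hu hg hE hx₀ hc h0 hx with hpos | hneg
  · refine h.not_deriv_pos hJ0 hu hg (c := c) (fun x hx => ?_) hpos
    have hmono : StrictMonoOn v (Ici c) := strictMonoOn_of_deriv_pos (convex_Ici c)
      h.continuous0.continuousOn fun y hy => by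
        rw [(h.deriv0 y).deriv]
        exact hpos y (by simpa using hy)
    -- The limit only yields a weak inequality; passing through `x + 1` makes `v x < 0` strict.
    have h1 : v (x + 1) ≤ 0 := ge_of_tendsto hlim (by
      filter_upwards [eventually_ge_atTop (x + 1)] with y hy
      exact hmono.monotoneOn (show c ≤ x + 1 by linarith) (show c ≤ y by linarith) hy)
    exact (hmono (show c ≤ x from hx.le) (show c ≤ x + 1 by linarith) (by linarith)).trans_le h1
  · have hanti : StrictAntiOn v (Ici c) := strictAntiOn_of_deriv_neg (convex_Ici c)
      h.continuous0.continuousOn fun y hy => by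
        rw [(h.deriv0 y).deriv]
        exact hneg y (by simpa using hy)
    have hge : ∀ x, c ≤ x → 0 ≤ v x := fun x hx => le_of_tendsto hlim (by
      filter_upwards [eventually_ge_atTop x] with y hy
      exact hanti.antitoneOn (show c ≤ x from hx) (show c ≤ y from hx.trans hy) hy)
    have hnn : ∀ x, 0 ≤ v x := fun x => by
      rcases le_total c x with hx | hx
      · exact hge x hx
      · rw [← h.symmetric hJ hu hg hE hc x]
        exact hge _ (by linarith)
    rw [energy_eq J hu hg] at hE
    have q1 := h.integral_mul_sq_nonpos hu hg hnn
    have q2 : 0 ≤ J * ∫ x, v x ^ 4 :=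
      mul_nonneg hJ0 (integral_nonneg fun x => by positivity)
    have q3 : 0 ≤ ∫ x, v2 x ^ 2 := integral_nonneg fun x => sq_nonneg _
    -- Three nonnegative terms sum to zero, so `v2 = 0` and `v1` is constantly `v1 c = 0`, against
    -- `hneg`.
    have q4 : ∫ x, v2 x ^ 2 = 0 := by linarith
    rw [integral_eq_zero_iff_of_nonneg (fun x => sq_nonneg _) hg.integrable_sq] at q4
    have q5 := (Continuous.ae_eq_iff_eq volume (h.continuous2.pow 2) continuous_const).1 q4
    have q6 : ∀ x, v2 x = 0 := fun x =>
      pow_eq_zero_iff two_ne_zero |>.1 (congrFun q5 x)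
    have q7 : v1 (c + 1) = v1 c := is_const_of_deriv_eq_zero
      (fun z => (h.deriv1 z).differentiableAt) (fun z => by rw [(h.deriv1 z).deriv, q6]) _ _
    have := hneg (c + 1) (by linarith)
    linarith

/-! ### Finiteness and sign of the infimum, and the conclusion. -/

theorem IsCompetitor.integral_pow_four_pos {u g : ℝ → ℝ} (h : IsCompetitor u g) :
    0 < ∫ x, u x ^ 4 := by
  refine lt_of_le_of_ne (integral_nonneg fun x => by positivity) fun h0 => h.not_ae_zero ?_
  have := (integral_eq_zero_iff_of_nonneg (fun x => by positivity)
    h.memLp_four.integrable_pow_four).1 h0.symm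
  filter_upwards [this] with x hx
  simpa using hx

theorem IsCompetitor.quotientQ_add {u g : ℝ → ℝ} (h : IsCompetitor u g) (J : ℝ) :
    quotientQ u g + J = energy J u g / ∫ x, u x ^ 4 := by
  rw [quotientQ, energy_eq J h.memLp_four h.memLp_two]
  field_simp [h.integral_pow_four_pos.ne']

theorem IsCompetitor.neg_quarter_le {u g : ℝ → ℝ} (h : IsCompetitor u g) :
    -(1 / 4) ≤ quotientQ u g := by
  have h1 := h.quotientQ_add (1 / 4)
  -- For `J = 1/4` the density is the perfect square `(g - u² / 2)²`.
  have h2 : 0 ≤ energy (1 / 4) u g := integral_nonneg fun x => by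
    simp only [Pi.zero_apply]
    nlinarith [sq_nonneg (g x - u x ^ 2 / 2)]
  have h3 := div_nonneg h2 h.integral_pow_four_pos.le
  linarith

theorem exists_isCompetitor : ∃ u g : ℝ → ℝ, IsCompetitor u g := by
  obtain ⟨ρ, hρ, hc, h1⟩ := exists_test_integral_eq_one
  refine ⟨ρ, deriv (deriv ρ), hρ.continuous.memLp_of_hasCompactSupport hc,
    isWeakSecondDeriv_test hρ, ((contDiff_deriv_test hρ).continuous_deriv
      (by simp)).memLp_of_hasCompactSupport hc.deriv.deriv, fun h => ?_⟩
  rw [integral_eq_zero_of_ae h] at h1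
  exact zero_ne_one h1

theorem isGLB_infimumI : IsGLB quotientValues infimumI := by
  obtain ⟨u, g, h⟩ := exists_isCompetitor
  refine isGLB_csInf ⟨_, u, g, h, rfl⟩ ⟨-(1 / 4), ?_⟩
  rintro _ ⟨u, g, h, rfl⟩
  exact h.neg_quarter_le

theorem energyNonneg_neg_infimumI : EnergyNonneg (-infimumI) := by
  intro u g hu hg hw
  by_cases h0 : ∀ᵐ x, u x = 0
  · rw [energy_congr _ (show u =ᵐ[volume] fun _ => 0 from h0) (ae_eq_refl g)]
    exact integral_nonneg fun x => by simp [sq_nonneg]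
  · have h : IsCompetitor u g := ⟨hu, hw, hg, h0⟩
    have h1 := isGLB_infimumI.1 ⟨u, g, h, rfl⟩
    have h2 := h.quotientQ_add (-infimumI)
    rw [eq_div_iff h.integral_pow_four_pos.ne'] at h2
    rw [← h2]
    exact mul_nonneg (by linarith) h.integral_pow_four_pos.le

/-- The quartic term dominates for large multiples of a fixed competitor: the energy of `u / t`,
multiplied by `t⁴`, tends to `J ∫ u⁴` as `t → 0`. -/
theorem EnergyNonneg.nonneg {J : ℝ} (hJ : EnergyNonneg J) : 0 ≤ J := by
  obtain ⟨u, g, h⟩ := exists_isCompetitor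
  have hu := h.memLp_four
  have hg := h.memLp_two
  set A := ∫ x, g x ^ 2
  set B := ∫ x, g x * u x ^ 2
  set C := ∫ x, u x ^ 4
  have key : ∀ t : ℝ, t ≠ 0 → 0 ≤ A * t ^ 2 - B * t + J * C := fun t ht => by
    have h1 := hJ _ _ (hu.const_mul t⁻¹) (hg.const_mul t⁻¹) (h.isWeakSecondDeriv.const_mul t⁻¹)
    rw [energy_eq J (hu.const_mul _) (hg.const_mul _)] at h1
    simp only [mul_pow] at h1
    have e : ∀ x, t⁻¹ * g x * (t⁻¹ ^ 2 * u x ^ 2) = t⁻¹ ^ 3 * (g x * u x ^ 2) := fun x => by ring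
    simp only [e, integral_const_mul] at h1
    have h2 := mul_nonneg h1 (show 0 ≤ t ^ 4 by positivity)
    have h3 : (t⁻¹ ^ 2 * A - t⁻¹ ^ 3 * B + J * (t⁻¹ ^ 4 * C)) * t ^ 4
        = A * t ^ 2 - B * t + J * C := by
      field_simp
    rwa [h3] at h2
  have hlim : Tendsto (fun t : ℝ => A * t ^ 2 - B * t + J * C) (𝓝[≠] 0) (𝓝 (J * C)) := by
    have : Continuous fun t : ℝ => A * t ^ 2 - B * t + J * C := by fun_prop
    have := this.tendsto 0
    simp only [ne_eq, OfNat.ofNat_ne_zero, not_false_eq_true, zero_pow, mul_zero, sub_zero,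
      zero_add] at this
    exact this.mono_left nhdsWithin_le_nhds
  have hJC : 0 ≤ J * C :=
    ge_of_tendsto hlim (eventually_mem_nhdsWithin.mono fun t ht => key t ht)
  exact nonneg_of_mul_nonneg_left hJC h.integral_pow_four_pos

/-- `I` is a genuine (finite) infimum, and it is not attained by any competitor on `ℝ`. -/
theorem mainTheorem4 :
    IsGLB quotientValues infimumI ∧
      ∀ u u2 : ℝ → ℝ, IsCompetitor u u2 → quotientQ u u2 ≠ infimumI := by
  refine ⟨isGLB_infimumI, fun u u2 h hq => ?_⟩
  refine energyNonneg_neg_infimumI.energy_ne_zero energyNonneg_neg_infimumI.nonneg h ?_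
  have h1 := h.quotientQ_add (-infimumI)
  rw [hq, add_neg_cancel, eq_comm, div_eq_zero_iff] at h1
  exact h1.resolve_right h.integral_pow_four_pos.ne'
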